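/- Let $0\le u<v$, $N\ge 1$ and $\mathsf t\ge 0$ ($N,\mathsf t$ integers). The discrete-time Bernoulli PushTASEP with step initial condition and jump probability $u/v$ is the following system of particles $x_1(\mathsf t)<x_2(\mathsf t)<\cdots$ on $\mathbb Z$. Initially $x_i(0)=i$ for all $i\ge1$. At each time step $\mathsf t\to\mathsf t+1$ every particle flips its own coin with probability of success $u/v$, all coins (over all particles and all time steps) being independent. Then, in the order $i=1,2,\ldots$, the particle $x_i$ jumps to the right by one if its coin is a success or if $i\ge2$ and $x_i(\mathsf t)=x_{i-1}(\mathsf t)+1=x_{i-1}(\mathsf t+1)$ (it is pushed by $x_{i-1}$); otherwise it stays put. Let $$\mathfrak h(\mathsf t,N)=\#\{i\ge1:\ x_i(\mathsf t)\le N\}.$$ Let $\mathsf{Sign}_N^+=\{\mu\in\mathbb Z^N:\ \mu_1\ge\cdots\ge\mu_N\ge0\}$, let $s_\mu$ denote the Schur symmetric polynomial, and let $\mu^{[0]}$ be the number of zero parts of $\mu\in\mathsf{Sign}_N^+$. Then $$\mathrm{Prob}(\mu)=\frac1Z\,s_\mu(\underbrace{v^{-1},\ldots,v^{-1}}_{\mathsf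 t})\,s_\mu(\underbrace{u,\ldots,u}_{N}),\qquad Z=\sum_{\mu\in\mathsf{Sign}_N^+}s_\mu(\underbrace{v^{-1},\ldots,v^{-1}}_{\mathsf t})\,s_\mu(\underbrace{u,\ldots,u}_{N}),$$ is a well-defined probability measure on $\mathsf{Sign}_N^+$ (the Schur measure), and if $\mu$ is distributed according to it, then $$\mathfrak h(\mathsf t,N)\stackrel{d}{=}\mu^{[0]}.$$ -/

import Mathlib

open MeasureTheory ProbabilityTheory

namespace PushTASEP

/-! ### The discrete-time Bernoulli PushTASEP -/

/-- One time step, with coins `c`. Particles are numbered `0, 1, 2, …` from left to right and are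
updated in this order: particle `i` jumps to the right by one if its coin is a success, or if
the particle to its left has just moved to the site occupied by particle `i`. -/
def step (c : ℕ → Bool) (x : ℕ → ℤ) : ℕ → ℤ
  | 0 => if c 0 then x 0 + 1 else x 0
  | i + 1 =>
      if c (i + 1) = true ∨ (x (i + 1) = x i + 1 ∧ x i + 1 = step c x i) then x (i + 1) + 1
      else x (i + 1)

/-- `position ξ t i` is the location at time `t` of particle number `i` (counted from `0`, so that
it is the particle usually called `x_{i+1}`), started from the step initial condition
`x_{i+1}(0) = i + 1`. The coin of this particle for the step `t → t + 1` is `ξ t i`. -/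
def position (ξ : ℕ → ℕ → Bool) : ℕ → ℕ → ℤ
  | 0 => fun i => (i : ℤ) + 1
  | t + 1 => step (ξ t) (position ξ t)

/-- The height function: the number of particles at time `t` at locations `≤ N`. -/
noncomputable def height (ξ : ℕ → ℕ → Bool) (t N : ℕ) : ℕ :=
  {i : ℕ | position ξ t i ≤ (N : ℤ)}.ncard

/-- The random coins `ξ t i` (time step `t → t + 1`, particle `i`) are independent and each is a
success with probability `p`. -/
structure IsBernoulliCoins {Ω : Type*} [MeasurableSpace Ω] (P : Measure Ω) (p : ℝ)
    (ξ : ℕ → ℕ → Ω → Bool) : Prop where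
  measurable : ∀ t i, Measurable (ξ t i)
  indep : iIndepFun (fun a : ℕ × ℕ => ξ a.1 a.2) P
  prob_success : ∀ t i, P {ω | ξ t i ω = true} = ENNReal.ofReal p

/-! ### Nonnegative signatures and Schur polynomials -/

/-- Nonnegative signatures `μ₁ ≥ μ₂ ≥ … ≥ μ_N ≥ 0` of length `N`. -/
def NonnegSignature (N : ℕ) : Type := {μ : Fin N → ℕ // Antitone μ}

instance (N : ℕ) : MeasurableSpace (NonnegSignature N) := ⊤

namespace NonnegSignature

/-- The Young diagram with row lengths `μ₁, …, μ_N`. -/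
def diagram {N : ℕ} (μ : NonnegSignature N) : YoungDiagram :=
  YoungDiagram.ofRowLens (List.ofFn μ.1) (List.sortedGE_ofFn_iff.mpr μ.2)

/-- The number of zero parts of `μ`. -/
def zeroParts {N : ℕ} (μ : NonnegSignature N) : ℕ :=
  (Finset.univ.filter fun i => μ.1 i = 0).card

end NonnegSignature

/-- Semistandard Young tableaux of shape `μ` with entries in `{0, …, n - 1}`. -/
def BoundedSSYT (μ : YoungDiagram) (n : ℕ) : Type :=
  {T : SemistandardYoungTableau μ // ∀ c : μ.cells, T c.1.1 c.1.2 < n}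

instance (μ : YoungDiagram) (n : ℕ) : Finite (BoundedSSYT μ n) := by
  refine Finite.of_injective
    (fun (T : BoundedSSYT μ n) (c : μ.cells) => (⟨T.1 c.1.1 c.1.2, T.2 c⟩ : Fin n)) ?_
  intro S T h
  refine Subtype.ext (SemistandardYoungTableau.ext fun i j => ?_)
  by_cases hc : (i, j) ∈ μ
  · exact congrArg Fin.val (congrFun h ⟨(i, j), hc⟩)
  · rw [S.1.zeros hc, T.1.zeros hc]

noncomputable instance (μ : YoungDiagram) (n : ℕ) : Fintype (BoundedSSYT μ n) :=
  Fintype.ofFinite _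

/-- The Schur polynomial `s_μ(x_0, …, x_{n-1})`: the generating function of semistandard Young
tableaux of shape `μ` with entries in `{0, …, n - 1}`. -/
noncomputable def schur (μ : YoungDiagram) {n : ℕ} (x : Fin n → ℝ) : ℝ :=
  ∑ T : BoundedSSYT μ n, ∏ c : μ.cells, x ⟨T.1 c.1.1 c.1.2, T.2 c⟩

/-! ### Schur measures -/

/-- The unnormalized weight `s_μ(x) s_μ(y)` of a signature. -/
noncomputable def schurWeight {t N : ℕ} (x : Fin t → ℝ) (y : Fin N → ℝ)
    (μ : NonnegSignature N) : ℝ :=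
  schur μ.diagram x * schur μ.diagram y

/-- The normalizing constant `Z = ∑_μ s_μ(x) s_μ(y)`, over nonnegative signatures of length `N`
(for nonnegative variables). -/
noncomputable def schurZ {t N : ℕ} (x : Fin t → ℝ) (y : Fin N → ℝ) : ENNReal :=
  ∑' μ : NonnegSignature N, ENNReal.ofReal (schurWeight x y μ)

/-- The Schur measure `Prob(μ) = s_μ(x) s_μ(y) / Z` on nonnegative signatures of length `N`
(for nonnegative variables). -/
noncomputable def schurMeasure {t N : ℕ} (x : Fin t → ℝ) (y : Fin N → ℝ) :
    Measure (NonnegSignature N) :=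
  Measure.sum fun μ => (ENNReal.ofReal (schurWeight x y μ) / schurZ x y) • Measure.dirac μ

end PushTASEP

namespace PushTASEP

/-! ### The local rule -/

/-! Put `q = u / v`. Both laws come from one Markov evolution of lists of `N` numbers, `rowKernel
q`.

Schur side: the weight of `μ` is `q ^ |μ|` times the numbers of tableaux of shape `μ` with `t` and
with `N` letters. A tableau with `N` letters is a chain of `N` horizontal strips from the empty
partition to `μ`; record the number of rows along the chain. Letters of the other tableau are
removed one at a time by a local rule (`exists_growth`): a bijection from pairs `(l, m)`, with `l`
below `κ` and `σ`, to the partitions `r` above both, of size `|κ| + |σ| - |l| + m`. It is chosen so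
that the number of rows of `r` depends only on those of `κ`, `σ`, `l` and on whether `m > 0`.
Summing the geometric weight of `m` leaves a factor `(1 - q)⁻¹` and a coin with success probability
`q`, so each letter applies the kernel once (`tsum_chainSum`, `tsum_card_mul_chainSum`).

Particle side: the numbers of holes in `1, …, j` satisfy the same max-recursion
(`Admissible.particleCount_step`), and the coins it reads are fresh (`lintegral_holeState`).

Both evolutions start from `N` zeros. Rows of `μ` thus correspond to holes in `1, …, N`, and zero
parts to particles. The constant test function gives `Z = (1 - q)⁻¹ ^ (N * t)`. -/

/-- Row lengths of the partitions below a pair of partitions, where `M` and `n` are the rowwise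
maximum and minimum of the pair. -/
abbrev LowerRows (M n : ℕ → ℕ) : Type := {l : ℕ → ℕ // ∀ i, M (i + 1) ≤ l i ∧ l i ≤ n i}

/-- Row lengths of the partitions above a pair of partitions, where `M` and `n` are the rowwise
maximum and minimum of the pair. -/
abbrev UpperRows (M n : ℕ → ℕ) : Type := {r : ℕ → ℕ // ∀ i, M i ≤ r i ∧ r (i + 1) ≤ n i}

/-- Row lengths of the result of the row insertion local rule. -/
def rowRuleFun (M n l : ℕ → ℕ) (m : ℕ) : ℕ → ℕ
  | 0 => M 0 + m
  | k + 1 => M (k + 1) + (n k - l k)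

/-- The row insertion local rule. -/
def rowRule (M n : ℕ → ℕ) (hMn : ∀ i, M (i + 1) ≤ n i) :
    LowerRows M n × ℕ ≃ UpperRows M n where
  toFun x := ⟨rowRuleFun M n x.1.1 x.2, by
    rintro (_ | i)
    · have := x.1.2 0; simp only [rowRuleFun]; omega
    · have := x.1.2 i; have := x.1.2 (i + 1); simp only [rowRuleFun]; omega⟩
  invFun r := (⟨fun i => M (i + 1) + n i - r.1 (i + 1), by
    intro i; have := r.2 i; have := r.2 (i + 1); dsimp only; omega⟩, r.1 0 - M 0)
  left_inv := by
    rintro ⟨l, m⟩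
    refine Prod.ext (Subtype.ext (funext fun i => ?_)) ?_
    · have := l.2 i; have := hMn i; simp only [rowRuleFun]; omega
    · simp only [rowRuleFun]; omega
  right_inv := by
    rintro r
    refine Subtype.ext (funext fun i => ?_)
    cases i with
    | zero => have := r.2 0; simp only [rowRuleFun]; omega
    | succ i => have := r.2 i; have := r.2 (i + 1); simp only [rowRuleFun]; omega

/-- The rows `0` and `k + 1` after exchanging boxes between them. -/
def toggleFun (M n : ℕ → ℕ) (k : ℕ) (r : ℕ → ℕ) (i : ℕ) : ℕ :=
  -- With `a = r 0 - M 0` and `b = r (k + 1)`, the sum `a + b` is kept and `b` ranges over `0, …,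
  -- min (n k) (a + b)`; the map reflects this interval.
  if i = 0 then r 0 + r (k + 1) - (min (n k) (r 0 - M 0 + r (k + 1)) - r (k + 1))
  else if i = k + 1 then min (n k) (r 0 - M 0 + r (k + 1)) - r (k + 1)
  else r i

/-- The involution that exchanges boxes between rows `0` and `k + 1`, where row `k + 1` is
the last one that may be nonempty. -/
def toggle (M n : ℕ → ℕ) (k : ℕ) (hM : M (k + 1) = 0) (hn : n (k + 1) = 0) :
    UpperRows M n ≃ UpperRows M n :=
  have key : ∀ r : UpperRows M n,
      ∀ i, M i ≤ toggleFun M n k r.1 i ∧ toggleFun M n k r.1 (i + 1) ≤ n i := by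
    intro r i
    have h0 := r.2 0
    have h1 := r.2 i
    have h2 := r.2 k
    have h3 := r.2 (k + 1)
    unfold toggleFun
    rcases eq_or_ne i 0 with rfl | hi
    · by_cases hk : k = 0
      · subst hk; simp; omega
      · have h01 : r.1 1 ≤ n 0 := h0.2
        simp [hk]; omega
    · by_cases hk : i = k + 1
      · subst hk; simp; omega
      · by_cases hk : i = k
        · subst hk; simp [hi]; omega
        · simp [*]
  have inv : ∀ r : UpperRows M n, toggleFun M n k (toggleFun M n k r.1) = r.1 := by
    intro r
    funext i
    have h0 := r.2 0
    have h2 := r.2 k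
    have h3 := r.2 (k + 1)
    unfold toggleFun
    rcases eq_or_ne i 0 with rfl | hi
    · simp; omega
    · by_cases hk : i = k + 1
      · subst hk; simp; omega
      · simp [*]
  { toFun r := ⟨toggleFun M n k r.1, key r⟩
    invFun r := ⟨toggleFun M n k r.1, key r⟩
    left_inv r := Subtype.ext (inv r)
    right_inv r := Subtype.ext (inv r) }

/-- The local rule whose effect on the number of rows depends on the numbers of rows only.
Here `L` is the number of rows of the union of the pair of partitions. -/
theorem exists_localRule (M n : ℕ → ℕ) (L : ℕ) (hMn : ∀ i, M (i + 1) ≤ n i)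
    (hM : ∀ i, L ≤ i → M i = 0) (hn : ∀ i, L ≤ i → n i = 0) :
    ∃ e : LowerRows M n × ℕ ≃ UpperRows M n, ∀ x,
      (∑ i ∈ Finset.range (L + 1), ((e x).1 i + x.1.1 i)
        = (∑ i ∈ Finset.range (L + 1), (M i + n i)) + x.2) ∧
      (0 < (e x).1 L ↔ 0 < x.2 ∧ ∀ k, k + 1 = L → 0 < x.1.1 k) := by
  have hrow : ∀ x, ∑ i ∈ Finset.range (L + 1), ((rowRule M n hMn x).1 i + x.1.1 i)
        = (∑ i ∈ Finset.range (L + 1), (M i + n i)) + x.2 := by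
    intro x
    have h1 : ∑ i ∈ Finset.range (L + 1), (rowRule M n hMn x).1 i
        = (∑ i ∈ Finset.range L, (M (i + 1) + (n i - x.1.1 i))) + (M 0 + x.2) := by
      rw [Finset.sum_range_succ']; rfl
    have h2 : ∑ i ∈ Finset.range (L + 1), x.1.1 i = ∑ i ∈ Finset.range L, x.1.1 i := by
      rw [Finset.sum_range_succ]
      have := x.1.2 L; have := hn L le_rfl; omega
    have h3 : ∑ i ∈ Finset.range (L + 1), n i = ∑ i ∈ Finset.range L, n i := by
      rw [Finset.sum_range_succ, hn L le_rfl, add_zero]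
    have h4 : ∑ i ∈ Finset.range L, (n i - x.1.1 i) + ∑ i ∈ Finset.range L, x.1.1 i
        = ∑ i ∈ Finset.range L, n i := by
      rw [← Finset.sum_add_distrib]
      refine Finset.sum_congr rfl fun i _ => ?_
      have := x.1.2 i; omega
    rw [Finset.sum_add_distrib, Finset.sum_add_distrib, h1, h2, h3,
      Finset.sum_range_succ' M, Finset.sum_add_distrib]
    omega
  rcases L with _ | k
  -- For `L = 0` the only new row is row `0`, of length `m`, and no exchange is needed.
  · refine ⟨rowRule M n hMn, fun x => ⟨hrow x, ?_⟩⟩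
    have : (rowRule M n hMn x).1 0 = M 0 + x.2 := rfl
    rw [this, hM 0 le_rfl]; simp
  -- Row insertion gives row `L = k + 1` the length `n k - l k`, whose sign is not governed by row
  -- counts. The reflection turns it into `min (l k) m`, positive exactly when both are.
  · refine ⟨(rowRule M n hMn).trans (toggle M n k (hM _ le_rfl) (hn _ le_rfl)),
      fun x => ⟨?_, ?_⟩⟩
    · rw [← hrow x, Finset.sum_add_distrib, Finset.sum_add_distrib]
      congr 1
      set r := rowRule M n hMn x
      change ∑ i ∈ Finset.range (k + 1 + 1), toggleFun M n k r.1 i = _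
      have hr0 := r.2 0
      have hrk := r.2 k
      rw [Finset.sum_range_succ', Finset.sum_range_succ, Finset.sum_range_succ' r.1,
        Finset.sum_range_succ fun i => r.1 (i + 1)]
      have : ∑ i ∈ Finset.range k, toggleFun M n k r.1 (i + 1)
          = ∑ i ∈ Finset.range k, r.1 (i + 1) := by
        refine Finset.sum_congr rfl fun i hi => ?_
        have : i ≠ k := (Finset.mem_range.1 hi).ne
        simp [toggleFun, this]
      rw [this]
      simp [toggleFun]; omega
    · change 0 < toggleFun M n k (rowRule M n hMn x).1 (k + 1) ↔ _
      have e0 : (rowRule M n hMn x).1 0 = M 0 + x.2 := rfl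
      have e1 : (rowRule M n hMn x).1 (k + 1) = M (k + 1) + (n k - x.1.1 k) := rfl
      have := x.1.2 k
      have := hM (k + 1) le_rfl
      simp only [toggleFun, e0, e1, Nat.succ_ne_zero, if_false, if_true, Nat.add_right_cancel_iff,
        forall_eq]
      omega

/-! ### Horizontal strips -/

/-- `μ / l` is a horizontal strip. -/
def HStrip (l μ : YoungDiagram) : Prop :=
  ∀ i, μ.rowLen (i + 1) ≤ l.rowLen i ∧ l.rowLen i ≤ μ.rowLen i

/-- The Young diagram with row lengths `f i`. -/
def ofRows (f : ℕ → ℕ) (hf : Antitone f) (n : ℕ) : YoungDiagram where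
  cells := (Finset.range n ×ˢ Finset.range (f 0)).filter fun c => c.2 < f c.1
  isLowerSet := by
    rintro ⟨i, j⟩ ⟨i', j'⟩ ⟨hi, hj⟩ h
    simp only [Finset.coe_filter, Finset.mem_product, Finset.mem_range, Set.mem_ofPred_eq] at h ⊢
    have := hf hi
    dsimp only at *
    omega

theorem rowLen_ofRows (f : ℕ → ℕ) (hf : Antitone f) (n : ℕ) (hn : ∀ i, n ≤ i → f i = 0) (i : ℕ) :
    (ofRows f hf n).rowLen i = f i := by
  refine eq_of_forall_lt_iff fun j => ?_
  rw [← YoungDiagram.mem_iff_lt_rowLen, ← YoungDiagram.mem_cells]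
  simp only [ofRows, Finset.mem_filter, Finset.mem_product, Finset.mem_range]
  have := hf (Nat.zero_le i)
  have := hn i
  omega

theorem youngDiagram_ext {μ ν : YoungDiagram} (h : ∀ i, μ.rowLen i = ν.rowLen i) : μ = ν := by
  refine YoungDiagram.ext (Finset.ext fun ⟨i, j⟩ => ?_)
  rw [YoungDiagram.mem_cells, YoungDiagram.mem_cells, YoungDiagram.mem_iff_lt_rowLen,
    YoungDiagram.mem_iff_lt_rowLen, h]

theorem lt_colLen_zero_iff {μ : YoungDiagram} {i : ℕ} : i < μ.colLen 0 ↔ 0 < μ.rowLen i := by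
  rw [← YoungDiagram.mem_iff_lt_colLen, YoungDiagram.mem_iff_lt_rowLen]

theorem rowLen_eq_zero_iff {μ : YoungDiagram} {i : ℕ} : μ.rowLen i = 0 ↔ μ.colLen 0 ≤ i := by
  have := lt_colLen_zero_iff (μ := μ) (i := i)
  omega

theorem card_eq_sum_rowLen (μ : YoungDiagram) {n : ℕ} (hn : μ.colLen 0 ≤ n) :
    μ.card = ∑ i ∈ Finset.range n, μ.rowLen i := by
  have : ∀ c ∈ μ.cells, c.1 ∈ Finset.range n := by
    rintro ⟨i, j⟩ hc
    rw [YoungDiagram.mem_cells, YoungDiagram.mem_iff_lt_rowLen] at hc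
    have := lt_colLen_zero_iff (μ := μ) (i := i)
    rw [Finset.mem_range]
    dsimp only
    omega
  rw [YoungDiagram.card, Finset.card_eq_sum_card_fiberwise this]
  exact Finset.sum_congr rfl fun i _ => (YoungDiagram.rowLen_eq_card μ).symm

theorem HStrip.card_le {l μ : YoungDiagram} (h : HStrip l μ) : l.card ≤ μ.card := by
  rw [card_eq_sum_rowLen l (le_max_left _ (μ.colLen 0)), card_eq_sum_rowLen μ (le_max_right _ _)]
  exact Finset.sum_le_sum fun i _ => (h i).2

section LocalRule

variable (κ σ : YoungDiagram)

/-- Rowwise maximum. -/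
def maxRow (i : ℕ) : ℕ := max (κ.rowLen i) (σ.rowLen i)

/-- Rowwise minimum. -/
def minRow (i : ℕ) : ℕ := min (κ.rowLen i) (σ.rowLen i)

variable {κ σ}

theorem LowerRows.antitone (f : LowerRows (maxRow κ σ) (minRow κ σ)) : Antitone f.1 :=
  antitone_nat_of_succ_le fun i => by
    have := f.2 i; have := f.2 (i + 1); simp only [maxRow, minRow] at *; omega

theorem LowerRows.eq_zero (f : LowerRows (maxRow κ σ) (minRow κ σ)) (i : ℕ)
    (hi : κ.colLen 0 ≤ i) : f.1 i = 0 := by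
  have := f.2 i; have := rowLen_eq_zero_iff.2 hi; simp only [maxRow, minRow] at *; omega

theorem UpperRows.antitone (f : UpperRows (maxRow κ σ) (minRow κ σ)) : Antitone f.1 :=
  antitone_nat_of_succ_le fun i => by
    have := f.2 i; have := f.2 (i + 1); simp only [maxRow, minRow] at *; omega

theorem UpperRows.eq_zero (f : UpperRows (maxRow κ σ) (minRow κ σ)) (i : ℕ)
    (hi : κ.colLen 0 + 1 ≤ i) : f.1 i = 0 := by
  obtain ⟨i, rfl⟩ := Nat.exists_eq_add_of_le' (Nat.one_le_of_lt hi)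
  have := f.2 i; have := rowLen_eq_zero_iff.2 (Nat.le_of_succ_le_succ hi)
  simp only [maxRow, minRow] at *; omega

variable (κ σ)

/-- Partitions below a pair of partitions, in terms of their row lengths. -/
def lowerEquiv : {l : YoungDiagram // HStrip l κ ∧ HStrip l σ} ≃
    LowerRows (maxRow κ σ) (minRow κ σ) where
  toFun l := ⟨l.1.rowLen, fun i => by
    have := l.2.1 i; have := l.2.2 i; simp only [maxRow, minRow]; omega⟩
  invFun f := ⟨ofRows f.1 f.antitone (κ.colLen 0), by
    constructor <;> intro i <;> rw [rowLen_ofRows _ _ _ f.eq_zero] <;> have := f.2 i <;>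
      simp only [maxRow, minRow] at * <;> omega⟩
  left_inv l := Subtype.ext (youngDiagram_ext fun i =>
    rowLen_ofRows _ (LowerRows.antitone (κ := κ) (σ := σ) ⟨_, _⟩) _
      (LowerRows.eq_zero (κ := κ) (σ := σ) ⟨_, _⟩) i)
  right_inv f := Subtype.ext (funext fun i => rowLen_ofRows _ f.antitone _ f.eq_zero i)

/-- Partitions above a pair of partitions, in terms of their row lengths. -/
def upperEquiv : {r : YoungDiagram // HStrip κ r ∧ HStrip σ r} ≃
    UpperRows (maxRow κ σ) (minRow κ σ) where
  toFun l := ⟨l.1.rowLen, fun i => by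
    have := l.2.1 i; have := l.2.2 i; simp only [maxRow, minRow]; omega⟩
  invFun f := ⟨ofRows f.1 f.antitone (κ.colLen 0 + 1), by
    constructor <;> intro i <;> simp only [rowLen_ofRows _ _ _ f.eq_zero] <;> have := f.2 i <;>
      simp only [maxRow, minRow] at * <;> omega⟩
  left_inv l := Subtype.ext (youngDiagram_ext fun i =>
    rowLen_ofRows _ (UpperRows.antitone (κ := κ) (σ := σ) ⟨_, _⟩) _
      (UpperRows.eq_zero (κ := κ) (σ := σ) ⟨_, _⟩) i)
  right_inv f := Subtype.ext (funext fun i => rowLen_ofRows _ f.antitone _ f.eq_zero i)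

theorem lowerEquiv_apply (l : {l : YoungDiagram // HStrip l κ ∧ HStrip l σ}) (i : ℕ) :
    (lowerEquiv κ σ l).1 i = l.1.rowLen i := by
  rfl

theorem upperEquiv_apply (r : {r : YoungDiagram // HStrip κ r ∧ HStrip σ r}) (i : ℕ) :
    (upperEquiv κ σ r).1 i = r.1.rowLen i := by
  rfl

/-- The number of rows produced by the local rule. -/
theorem exists_growth : ∃ e : {l : YoungDiagram // HStrip l κ ∧ HStrip l σ} × ℕ ≃
      {r : YoungDiagram // HStrip κ r ∧ HStrip σ r}, ∀ x,
    (e x).1.card + x.1.1.card = κ.card + σ.card + x.2 ∧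
    (e x).1.colLen 0 = max (κ.colLen 0)
      (max (σ.colLen 0) (x.1.1.colLen 0 + if x.2 = 0 then 0 else 1)) := by
  -- If this fails, no partition lies below both or above both, and the empty bijection serves.
  by_cases hne : ∀ i, maxRow κ σ (i + 1) ≤ minRow κ σ i
  swap
  · have h1 : IsEmpty {l : YoungDiagram // HStrip l κ ∧ HStrip l σ} := by
      refine ⟨fun l => hne fun i => ?_⟩
      have := l.2.1 i; have := l.2.2 i; simp only [maxRow, minRow]; omega
    have h2 : IsEmpty {r : YoungDiagram // HStrip κ r ∧ HStrip σ r} := by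
      refine ⟨fun l => hne fun i => ?_⟩
      have := l.2.1 i; have := l.2.2 i; have := l.2.1 (i + 1); have := l.2.2 (i + 1)
      simp only [maxRow, minRow]; omega
    exact ⟨Equiv.equivOfIsEmpty _ _, fun x => isEmptyElim x.1⟩
  set L := max (κ.colLen 0) (σ.colLen 0) with hL
  have hzero : ∀ i, L ≤ i → κ.rowLen i = 0 ∧ σ.rowLen i = 0 := fun i hi =>
    ⟨rowLen_eq_zero_iff.2 (by omega), rowLen_eq_zero_iff.2 (by omega)⟩
  obtain ⟨e, he⟩ := exists_localRule (maxRow κ σ) (minRow κ σ) L hne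
    (fun i hi => by have := hzero i hi; simp only [maxRow]; omega)
    (fun i hi => by have := hzero i hi; simp only [minRow]; omega)
  refine ⟨((lowerEquiv κ σ).prodCongr (Equiv.refl ℕ)).trans (e.trans (upperEquiv κ σ).symm),
    fun x => ?_⟩
  set y : LowerRows _ _ × ℕ := ((lowerEquiv κ σ).prodCongr (Equiv.refl ℕ)) x
  set r := (((lowerEquiv κ σ).prodCongr (Equiv.refl ℕ)).trans (e.trans (upperEquiv κ σ).symm)) x
    with hr
  have hre : ∀ i, (e y).1 i = r.1.rowLen i := fun i => by
    have : upperEquiv κ σ r = e y := by simp [hr, y]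
    rw [← this, upperEquiv_apply]
  have hxe : ∀ i, y.1.1 i = x.1.1.rowLen i := lowerEquiv_apply κ σ x.1
  obtain ⟨h1, h2⟩ := he y
  simp only [hre, hxe] at h1 h2
  have hy2 : y.2 = x.2 := rfl
  rw [hy2] at h1 h2
  have hrlen : r.1.colLen 0 ≤ L + 1 := by
    rw [← rowLen_eq_zero_iff]
    have := r.2.1 L; have := hzero L le_rfl; omega
  have hxlen : x.1.1.colLen 0 ≤ L := by
    rw [← rowLen_eq_zero_iff]
    have := x.1.2.1 L; have := hzero L le_rfl; omega
  constructor
  · rw [card_eq_sum_rowLen r.1 hrlen, card_eq_sum_rowLen x.1.1 (hxlen.trans (Nat.le_succ L)),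
      card_eq_sum_rowLen κ (n := L + 1) (by omega), card_eq_sum_rowLen σ (n := L + 1) (by omega),
      ← Finset.sum_add_distrib, h1, ← Finset.sum_add_distrib]
    congr 1
    refine Finset.sum_congr rfl fun i _ => ?_
    simp only [maxRow, minRow]; omega
  · have hrL : L ≤ r.1.colLen 0 := by
      rcases Nat.eq_zero_or_pos L with h | h
      · omega
      · obtain ⟨k, hk⟩ := Nat.exists_eq_add_of_le' h
        have h3 : k < r.1.colLen 0 := by
          rw [lt_colLen_zero_iff]
          have := r.2.1 k; have := r.2.2 k
          have := lt_colLen_zero_iff (μ := κ) (i := k)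
          have := lt_colLen_zero_iff (μ := σ) (i := k)
          omega
        omega
    -- As `r` has `L` or `L + 1` rows, only whether its row `L` is nonempty remains to be decided.
    have h4 := lt_colLen_zero_iff (μ := r.1) (i := L)
    rcases Nat.eq_zero_or_pos L with h | h
    · have h5 : ∀ k, k + 1 = L → 0 < x.1.1.rowLen k := by omega
      replace h2 := h2.trans (and_iff_left h5)
      split_ifs <;> omega
    · obtain ⟨k, hk⟩ := Nat.exists_eq_add_of_le' h
      have h5 := lt_colLen_zero_iff (μ := x.1.1) (i := k)
      rw [hk] at h2
      simp only [Nat.add_right_cancel_iff, forall_eq] at h2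
      rw [← hk] at h2
      split_ifs <;> omega

end LocalRule

/-! ### Sums over chains of partitions -/

open scoped Classical in
/-- The local rule as an identity of generating functions. -/
theorem tsum_upper_eq_tsum_lower (q : ENNReal) (f : ℕ → ENNReal) (κ σ : YoungDiagram) :
    ∑' r : YoungDiagram, (if HStrip κ r ∧ HStrip σ r then
        q ^ (r.card - κ.card) * f (r.colLen 0) else 0)
      = ∑' l : YoungDiagram, (if HStrip l κ ∧ HStrip l σ then
        q ^ (σ.card - l.card) * ∑' m : ℕ, q ^ m * f (max (κ.colLen 0)
          (max (σ.colLen 0) (l.colLen 0 + if m = 0 then 0 else 1))) else 0) := by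
  obtain ⟨e, he⟩ := exists_growth κ σ
  have h1 := tsum_subtype {r : YoungDiagram | HStrip κ r ∧ HStrip σ r}
    fun r => q ^ (r.card - κ.card) * f (r.colLen 0)
  have h2 := tsum_subtype {l : YoungDiagram | HStrip l κ ∧ HStrip l σ}
    fun l => q ^ (σ.card - l.card) * ∑' m : ℕ, q ^ m * f (max (κ.colLen 0)
          (max (σ.colLen 0) (l.colLen 0 + if m = 0 then 0 else 1)))
  simp only [Set.indicator_apply, Set.mem_ofPred_eq] at h1 h2
  rw [← h1, ← h2]
  -- Along the bijection `|r| - |κ| = (|σ| - |l|) + m`, so the weight factors.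
  refine (e.tsum_eq _).symm.trans ?_
  refine ENNReal.tsum_prod'.trans ?_
  refine tsum_congr fun l => ?_
  rw [← ENNReal.tsum_mul_left]
  refine tsum_congr fun m => ?_
  obtain ⟨h3, h4⟩ := he (l, m)
  have h5 := (e (l, m)).2.1.card_le
  have h6 := l.2.2.card_le
  rw [h4, ← mul_assoc, ← pow_add]
  congr 2
  dsimp only at *
  omega

/-- The Bernoulli expectation of `g`, multiplied by the sum of the geometric series. -/
theorem tsum_geometric_step (q : ENNReal) (hq : q < 1) (g : ℕ → ENNReal) :
    ∑' m : ℕ, q ^ m * g (if m = 0 then 0 else 1) = (1 - q)⁻¹ * ((1 - q) * g 0 + q * g 1) := by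
  rw [tsum_eq_zero_add' ENNReal.summable]
  have h1 : (1 - q) ≠ 0 := (tsub_pos_of_lt hq).ne'
  have h2 : (1 - q) ≠ ⊤ := ENNReal.sub_ne_top ENNReal.one_ne_top
  simp only [pow_zero, if_true, one_mul, Nat.add_eq_zero_iff, one_ne_zero, and_false, if_false,
    pow_succ', mul_assoc]
  rw [ENNReal.tsum_mul_left, ENNReal.tsum_mul_right, ENNReal.tsum_geometric, mul_add,
    ← mul_assoc (1 - q)⁻¹ (1 - q), ENNReal.inv_mul_cancel h1 h2, one_mul,
    mul_left_comm q]

/-- The new value obtained from the previous value `m` at the same place, the list `l'` of new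
values and the list `l` of old values to the left, and the coin `w`. -/
def nextLen (m : ℕ) (l l' : List ℕ) (w : ℕ) : ℕ :=
  max m (max (l'.headD 0) (l.headD 0 + w))

/-- One step of the evolution of the lists of numbers of rows. -/
noncomputable def rowKernel (q : ENNReal) : (List ℕ → ENNReal) → List ℕ → ENNReal
  | F, [] => F []
  | F, m :: l => rowKernel q (fun l' =>
      (1 - q) * F (nextLen m l l' 0 :: l') + q * F (nextLen m l l' 1 :: l')) l

theorem rowKernel_const_mul (q c : ENNReal) (F : List ℕ → ENNReal) (l : List ℕ) :
    rowKernel q (fun L => c * F L) l = c * rowKernel q F l := by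
  induction l generalizing F with
  | nil => rfl
  | cons m l ih =>
    simp only [rowKernel]
    rw [← ih]
    congr 1
    funext l'
    ring

open scoped Classical in
/-- The sum of `F` over chains of `n` horizontal strips from the empty partition to `μ`, where `F`
is evaluated at the list of the numbers of rows in the chain, the last one first. -/
noncomputable def chainSum : ℕ → YoungDiagram → (List ℕ → ENNReal) → ENNReal
  | 0, μ, F => if μ = ⊥ then F [] else 0
  | n + 1, μ, F => ∑' l : YoungDiagram, if HStrip l μ then
      chainSum n l (fun L => F (μ.colLen 0 :: L)) else 0

theorem hstrip_bot_iff {μ : YoungDiagram} : HStrip μ ⊥ ↔ μ = ⊥ := by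
  have h0 : ∀ i, (⊥ : YoungDiagram).rowLen i = 0 := fun i => by
    rw [← Nat.le_zero, ← not_lt, ← YoungDiagram.mem_iff_lt_rowLen]
    exact YoungDiagram.notMem_bot _
  refine ⟨fun h => youngDiagram_ext fun i => ?_, ?_⟩
  · have := h i; have := h0 i; omega
  · rintro rfl i; simp [h0]

theorem colLen_bot : (⊥ : YoungDiagram).colLen 0 = 0 := by
  rw [← Nat.le_zero, ← not_lt, ← YoungDiagram.mem_iff_lt_colLen]
  exact YoungDiagram.notMem_bot _

/-- The recorded list starts with the number of rows of `μ` itself. For `n = 0` it is empty, and the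
default `0` is the number of rows of `⊥`. -/
theorem chainSum_congr (n : ℕ) (μ : YoungDiagram) {F G : List ℕ → ENNReal}
    (h : ∀ L, L.headD 0 = μ.colLen 0 → F L = G L) : chainSum n μ F = chainSum n μ G := by
  cases n with
  | zero =>
    simp only [chainSum]
    split_ifs with hμ
    · subst hμ; exact h [] (by rw [colLen_bot]; rfl)
    · rfl
  | succ n =>
    have e : (fun L => F (μ.colLen 0 :: L)) = fun L => G (μ.colLen 0 :: L) :=
      funext fun L => h _ rfl
    simp only [chainSum, e]

theorem chainSum_const_mul (n : ℕ) (μ : YoungDiagram) (c : ENNReal) (F : List ℕ → ENNReal) :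
    chainSum n μ (fun L => c * F L) = c * chainSum n μ F := by
  induction n generalizing μ F with
  | zero => simp only [chainSum, mul_ite, mul_zero]
  | succ n ih => simp only [chainSum, ih, ← ENNReal.tsum_mul_left, mul_ite, mul_zero]

theorem chainSum_tsum {ι : Type*} (n : ℕ) (μ : YoungDiagram) (F : ι → List ℕ → ENNReal) :
    chainSum n μ (fun L => ∑' a, F a L) = ∑' a, chainSum n μ (F a) := by
  classical
  induction n generalizing μ F with
  | zero =>
    simp only [chainSum]
    split_ifs <;> simp
  | succ n ih =>
    simp only [chainSum, ih]
    rw [ENNReal.tsum_comm]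
    refine tsum_congr fun l => ?_
    split_ifs <;> simp

theorem chainSum_ite (n : ℕ) (μ : YoungDiagram) (P : Prop) [Decidable P] (F : List ℕ → ENNReal) :
    chainSum n μ (fun L => if P then F L else 0) = if P then chainSum n μ F else 0 := by
  split_ifs
  · rfl
  · simpa using chainSum_const_mul n μ 0 fun _ => 0

open scoped Classical in
/-- Adding a column to the growth diagram. -/
theorem tsum_chainSum (q : ENNReal) (hq : q < 1) (n : ℕ) (κ : YoungDiagram)
    (F : List ℕ → ENNReal) :
    ∑' r : YoungDiagram, (if HStrip κ r then q ^ (r.card - κ.card) * chainSum n r F else 0)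
      = (1 - q)⁻¹ ^ n * chainSum n κ (rowKernel q F) := by
  induction n generalizing κ F with
  | zero =>
    rw [tsum_eq_single ⊥]
    · by_cases h : κ = ⊥
      · subst h; simp [chainSum, rowKernel, hstrip_bot_iff]
      · simp [chainSum, hstrip_bot_iff, h]
    · intro r hr; simp [chainSum, hr]
  | succ n ih =>
    -- Here `σ` is the shape just before `r` in the chain. The local rule trades `r` for `(l, m)`,
    -- and the row count of `σ` is read off as the head of `L'`.
    have h1 : ∀ σ : YoungDiagram,
        ∑' r : YoungDiagram, (if HStrip κ r ∧ HStrip σ r then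
          q ^ (r.card - κ.card) * chainSum n σ (fun L => F (r.colLen 0 :: L)) else 0)
        = ∑' l : YoungDiagram, if HStrip l κ ∧ HStrip l σ then
          q ^ (σ.card - l.card) * chainSum n σ (fun L' => ∑' m : ℕ, q ^ m *
            F (max (κ.colLen 0) (max (L'.headD 0) (l.colLen 0 + if m = 0 then 0 else 1)) :: L'))
          else 0 := by
      intro σ
      have h2 := chainSum_congr n σ (F := fun L => _) (G := fun L => _)
        fun L hL => tsum_upper_eq_tsum_lower q (fun a => F (a :: L)) κ σ
      rw [chainSum_tsum, chainSum_tsum] at h2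
      simp only [chainSum_ite, chainSum_const_mul] at h2
      rw [h2]
      refine tsum_congr fun l => ?_
      split_ifs
      · congr 1
        refine chainSum_congr n σ fun L hL => ?_
        rw [hL]
      · rfl
    calc _ = ∑' σ : YoungDiagram, ∑' r : YoungDiagram, (if HStrip κ r ∧ HStrip σ r then
          q ^ (r.card - κ.card) * chainSum n σ (fun L => F (r.colLen 0 :: L)) else 0) := by
          rw [ENNReal.tsum_comm]
          refine tsum_congr fun r => ?_
          simp only [chainSum, ← ENNReal.tsum_mul_left]
          split_ifs with h
          · simp [h]
          · simp [h]
      _ = ∑' l : YoungDiagram, ∑' σ : YoungDiagram, if HStrip l κ ∧ HStrip l σ then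
          q ^ (σ.card - l.card) * chainSum n σ (fun L' => ∑' m : ℕ, q ^ m *
            F (max (κ.colLen 0) (max (L'.headD 0) (l.colLen 0 + if m = 0 then 0 else 1)) :: L'))
          else 0 := (tsum_congr h1).trans ENNReal.tsum_comm
      _ = _ := by
          simp only [chainSum, ← ENNReal.tsum_mul_left]
          refine tsum_congr fun l => ?_
          -- The sum over `σ` is now the induction hypothesis with `l` in place of `κ`; the sum over
          -- `m` supplies the last factor `(1 - q)⁻¹` and the coin of the head entry.
          by_cases h : HStrip l κ
          · simp only [h, true_and, if_true]
            rw [ih, pow_succ, mul_assoc, ← chainSum_const_mul n l (1 - q)⁻¹]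
            congr 1
            refine chainSum_congr n l fun L hL => ?_
            simp only [rowKernel]
            rw [← rowKernel_const_mul]
            congr 1
            funext L'
            rw [tsum_geometric_step q hq fun w =>
              F (max (κ.colLen 0) (max (L'.headD 0) (l.colLen 0 + w)) :: L')]
            simp only [nextLen, hL]
          · simp [h]

/-! ### Tableaux as chains of horizontal strips -/

theorem hstrip_iff {l μ : YoungDiagram} :
    HStrip l μ ↔ l ≤ μ ∧ ∀ i j, (i + 1, j) ∈ μ → (i, j) ∈ l := by
  constructor
  · intro h
    refine ⟨?_, fun i j => ?_⟩
    · rintro ⟨i, j⟩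
      rw [YoungDiagram.mem_iff_lt_rowLen, YoungDiagram.mem_iff_lt_rowLen]
      have := h i; omega
    · rw [YoungDiagram.mem_iff_lt_rowLen, YoungDiagram.mem_iff_lt_rowLen]
      have := h i; omega
  · rintro ⟨h1, h2⟩ i
    constructor
    · refine le_of_forall_lt fun j hj => ?_
      rw [← YoungDiagram.mem_iff_lt_rowLen] at hj ⊢
      exact h2 i j hj
    · refine le_of_forall_lt fun j hj => ?_
      rw [← YoungDiagram.mem_iff_lt_rowLen] at hj ⊢
      exact h1 hj

/-- Add a horizontal strip filled with the entry `n` to a tableau with entries below `n`. -/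
def extendTableau {l μ : YoungDiagram} {n : ℕ} (h : HStrip l μ) (S : BoundedSSYT l n) :
    BoundedSSYT μ (n + 1) :=
  have hS : ∀ i j, (i, j) ∈ l → S.1 i j < n := fun i j hc => S.2 ⟨(i, j), hc⟩
  ⟨{  entry := fun i j => if (i, j) ∈ l then S.1 i j else if (i, j) ∈ μ then n else 0
      row_weak' := by
        intro i j1 j2 hj hc
        have h1 : (i, j1) ∈ μ := μ.up_left_mem le_rfl hj.le hc
        by_cases h2 : (i, j2) ∈ l
        · simp only [h2, l.up_left_mem le_rfl hj.le h2, if_true]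
          exact S.1.row_weak hj h2
        · by_cases h3 : (i, j1) ∈ l
          · simp only [h2, h3, hc, if_true, if_false]
            exact (hS _ _ h3).le
          · simp only [h2, h3, hc, h1, if_true, if_false, le_refl]
      col_strict' := by
        intro i1 i2 j hi hc
        have h1 : (i1, j) ∈ l :=
          (hstrip_iff.1 h).2 i1 j (μ.up_left_mem (Nat.succ_le_of_lt hi) le_rfl hc)
        by_cases h2 : (i2, j) ∈ l
        · simp only [h1, h2, if_true]
          exact S.1.col_strict hi h2
        · simp only [h1, h2, hc, if_true, if_false]
          exact hS _ _ h1
      zeros' := by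
        intro i j hc
        have h1 : (i, j) ∉ l := fun h1 => hc ((hstrip_iff.1 h).1 h1)
        simp only [h1, hc, if_false] },
    by
      rintro ⟨⟨i, j⟩, hc⟩
      change (if (i, j) ∈ l then S.1 i j else if (i, j) ∈ μ then n else 0) < n + 1
      split_ifs with h1
      · exact (hS _ _ h1).trans (Nat.lt_succ_self n)
      · omega
      · omega⟩

theorem extendTableau_apply {l μ : YoungDiagram} {n : ℕ} (h : HStrip l μ) (S : BoundedSSYT l n)
    (i j : ℕ) : (extendTableau h S).1 i j
      = if (i, j) ∈ l then S.1 i j else if (i, j) ∈ μ then n else 0 := by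
  rfl

theorem mem_iff_extendTableau_lt {l μ : YoungDiagram} {n : ℕ} (h : HStrip l μ)
    (S : BoundedSSYT l n) (i j : ℕ) :
    (i, j) ∈ l ↔ (i, j) ∈ μ ∧ (extendTableau h S).1 i j < n := by
  rw [extendTableau_apply]
  by_cases h1 : (i, j) ∈ l
  · simp only [h1, if_true, true_iff]
    exact ⟨(hstrip_iff.1 h).1 h1, S.2 ⟨(i, j), h1⟩⟩
  · by_cases h2 : (i, j) ∈ μ <;> simp [h1, h2]

/-- Strict columns contain the largest letter `n` at most once, at the bottom, so its cells form a
horizontal strip. The inner shape is recovered as the set of cells with entry below `n`. -/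
theorem extendTableau_bijective (μ : YoungDiagram) (n : ℕ) : Function.Bijective
    fun x : Σ l : {l : YoungDiagram // HStrip l μ}, BoundedSSYT l.1 n =>
      extendTableau x.1.2 x.2 := by
  constructor
  · rintro ⟨⟨l, h⟩, S⟩ ⟨⟨l', h'⟩, S'⟩ he
    dsimp only at he
    have : l = l' := by
      refine YoungDiagram.ext (Finset.ext fun ⟨i, j⟩ => ?_)
      rw [YoungDiagram.mem_cells, YoungDiagram.mem_cells, mem_iff_extendTableau_lt h S,
        mem_iff_extendTableau_lt h' S', he]
    subst this
    have : S = S' := by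
      refine Subtype.ext (SemistandardYoungTableau.ext fun i j => ?_)
      by_cases hc : (i, j) ∈ l
      · have h1 := extendTableau_apply h S i j
        have h2 := extendTableau_apply h' S' i j
        simp only [hc, if_true] at h1 h2
        rw [← h1, ← h2, he]
      · rw [S.1.zeros hc, S'.1.zeros hc]
    rw [this]
  · intro T
    have hT : ∀ i j, (i, j) ∈ μ → T.1 i j < n + 1 := fun i j hc => T.2 ⟨(i, j), hc⟩
    let l : YoungDiagram :=
      { cells := μ.cells.filter fun c => T.1 c.1 c.2 < n
        isLowerSet := by
          rintro ⟨i, j⟩ ⟨i', j'⟩ ⟨hi, hj⟩ hc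
          simp only [Finset.coe_filter, YoungDiagram.mem_cells, Set.mem_ofPred_eq] at hc ⊢
          refine ⟨μ.up_left_mem hi hj hc.1, lt_of_le_of_lt ?_ hc.2⟩
          exact (T.1.row_weak_of_le hj (μ.up_left_mem hi le_rfl hc.1)).trans
            (T.1.col_weak hi hc.1) }
    have hl : ∀ i j, (i, j) ∈ l ↔ (i, j) ∈ μ ∧ T.1 i j < n := by
      intro i j
      rw [← YoungDiagram.mem_cells, Finset.mem_filter, YoungDiagram.mem_cells]
    have h : HStrip l μ := by
      refine hstrip_iff.2 ⟨fun ⟨i, j⟩ hc => ((hl i j).1 hc).1, fun i j hc => ?_⟩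
      refine (hl i j).2 ⟨μ.up_left_mem (Nat.le_succ i) le_rfl hc, ?_⟩
      have h1 := T.1.col_strict (Nat.lt_add_one i) hc
      have h2 := hT _ _ hc
      omega
    let S : BoundedSSYT l n :=
      ⟨{  entry := fun i j => if (i, j) ∈ l then T.1 i j else 0
          row_weak' := by
            intro i j1 j2 hj hc
            simp only [hc, l.up_left_mem le_rfl hj.le hc, if_true]
            exact T.1.row_weak hj ((hl _ _).1 hc).1
          col_strict' := by
            intro i1 i2 j hi hc
            simp only [hc, l.up_left_mem hi.le le_rfl hc, if_true]
            exact T.1.col_strict hi ((hl _ _).1 hc).1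
          zeros' := by
            intro i j hc
            simp only [hc, if_false] },
        by
          rintro ⟨⟨i, j⟩, hc⟩
          change (if (i, j) ∈ l then T.1 i j else 0) < n
          rw [YoungDiagram.mem_cells] at hc
          rw [if_pos hc]
          exact ((hl i j).1 hc).2⟩
    have hS : ∀ i j, S.1 i j = if (i, j) ∈ l then T.1 i j else 0 := fun i j => rfl
    refine ⟨⟨⟨l, h⟩, S⟩, Subtype.ext (SemistandardYoungTableau.ext fun i j => ?_)⟩
    rw [extendTableau_apply, hS]
    by_cases hc : (i, j) ∈ μ
    · have h1 := hT _ _ hc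
      have h2 := hl i j
      simp only [hc, true_and, if_true] at h2 ⊢
      split_ifs with h3
      · rfl
      · rw [h2] at h3; omega
    · have h2 := hl i j
      simp only [hc, false_and, iff_false] at h2
      simp only [hc, h2, if_false, T.1.zeros hc]

theorem chainSum_one (n : ℕ) (μ : YoungDiagram) :
    chainSum n μ (fun _ => 1) = Fintype.card (BoundedSSYT μ n) := by
  classical
  have key : chainSum n μ (fun _ => 1) = ∑' _ : BoundedSSYT μ n, 1 := by
    induction n generalizing μ with
    | zero =>
      simp only [chainSum]
      split_ifs with h
      · subst h
        have hempty : ∀ c : (⊥ : YoungDiagram).cells, False := fun c =>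
          YoungDiagram.notMem_bot _ ((YoungDiagram.mem_cells _).1 c.2)
        let T : BoundedSSYT ⊥ 0 :=
          ⟨SemistandardYoungTableau.highestWeight ⊥, fun c => (hempty c).elim⟩
        rw [tsum_eq_single T]
        intro T' hT'
        refine absurd (Subtype.ext (SemistandardYoungTableau.ext fun i j => ?_)) hT'
        rw [T'.1.zeros (YoungDiagram.notMem_bot _), T.1.zeros (YoungDiagram.notMem_bot _)]
      · have : IsEmpty (BoundedSSYT μ 0) := by
          refine ⟨fun T => h (YoungDiagram.ext (Finset.eq_empty_of_forall_notMem fun c hc => ?_))⟩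
          exact absurd (T.2 ⟨c, hc⟩) (Nat.not_lt_zero _)
        simp
    | succ n ih =>
      rw [← (Equiv.ofBijective _ (extendTableau_bijective μ n)).tsum_eq, ENNReal.tsum_sigma']
      have h1 := tsum_subtype {l : YoungDiagram | HStrip l μ}
        fun l => ∑' _ : BoundedSSYT l n, (1 : ENNReal)
      refine Eq.trans ?_ h1.symm
      simp only [chainSum, ih, Set.indicator_apply, Set.mem_ofPred_eq]
  rw [key, tsum_fintype]
  simp

theorem card_boundedSSYT_succ (μ : YoungDiagram) (n : ℕ) [DecidablePred fun l => HStrip l μ] :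
    (Fintype.card (BoundedSSYT μ (n + 1)) : ENNReal)
      = ∑' l : YoungDiagram, if HStrip l μ then (Fintype.card (BoundedSSYT l n) : ENNReal)
        else 0 := by
  rw [← chainSum_one]
  simp only [chainSum, chainSum_one]

/-- The unnormalized expectation, with respect to a Schur measure, of a function of the numbers of
rows in a chain. -/
theorem tsum_card_mul_chainSum (q : ENNReal) (hq : q < 1) (t N : ℕ) (F : List ℕ → ENNReal) :
    ∑' μ : YoungDiagram, q ^ μ.card * Fintype.card (BoundedSSYT μ t) * chainSum N μ F
      = (1 - q)⁻¹ ^ (N * t) * ((rowKernel q)^[t] F) (List.replicate N 0) := by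
  classical
  induction t generalizing F with
  | zero =>
    rw [tsum_eq_single ⊥]
    · have h : ∀ (n : ℕ) (F : List ℕ → ENNReal), chainSum n ⊥ F = F (List.replicate n 0) := by
        intro n
        induction n with
        | zero => intro F; simp [chainSum]
        | succ n ih =>
          intro F
          simp only [chainSum]
          rw [tsum_eq_single ⊥]
          · rw [if_pos (hstrip_bot_iff.2 rfl), ih, colLen_bot]; rfl
          · intro l hl; rw [if_neg (mt hstrip_bot_iff.1 hl)]
      rw [← chainSum_one]
      simp [chainSum, h, YoungDiagram.card]
    · intro μ hμ
      rw [← chainSum_one]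
      simp [chainSum, hμ]
  | succ t ih =>
    rw [Function.iterate_succ_apply, mul_add_one, pow_add, mul_right_comm, ← ih,
      ← ENNReal.tsum_mul_right]
    simp only [card_boundedSSYT_succ, ← ENNReal.tsum_mul_left, ← ENNReal.tsum_mul_right]
    rw [ENNReal.tsum_comm]
    -- `κ` is the shape left after deleting the largest of the `t + 1` letters; for fixed `κ`, the
    -- sum over `μ` is `tsum_chainSum`.
    refine tsum_congr fun κ => ?_
    have h := tsum_chainSum q hq N κ F
    rw [mul_assoc, mul_comm (chainSum _ _ _), ← h, ← ENNReal.tsum_mul_left]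
    refine tsum_congr fun μ => ?_
    split_ifs with hs
    · rw [← Nat.add_sub_of_le hs.card_le, pow_add, Nat.add_sub_cancel_left]
      ring
    · simp

/-! ### The evolution of the numbers of holes -/

/-- Configurations that can be reached from the step initial condition. -/
structure Admissible (x : ℕ → ℤ) : Prop where
  lt_succ : ∀ i, x i < x (i + 1)
  le : ∀ i : ℕ, (i : ℤ) + 1 ≤ x i

theorem step_eq_or (c : ℕ → Bool) (x : ℕ → ℤ) (i : ℕ) :
    step c x i = x i ∨ step c x i = x i + 1 := by
  cases i <;> simp only [step] <;> split_ifs <;> simp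

theorem Admissible.step {x : ℕ → ℤ} (hx : Admissible x) (c : ℕ → Bool) :
    Admissible (step c x) := by
  refine ⟨fun i => ?_, fun i => ?_⟩
  · have h1 := hx.lt_succ i
    have h2 := step_eq_or c x i
    simp only [PushTASEP.step]
    split_ifs with h
    · omega
    · push Not at h
      have := h.2
      omega
  · have h1 := hx.le i
    have h2 := step_eq_or c x i
    omega

theorem admissible_position (ξ : ℕ → ℕ → Bool) (t : ℕ) : Admissible (position ξ t) := by
  induction t with
  | zero => exact ⟨fun i => by simp [position], fun i => le_rfl⟩
  | succ t ih => exact ih.step _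

/-- The number of particles at locations `≤ j`. -/
noncomputable def particleCount (x : ℕ → ℤ) (j : ℕ) : ℕ := {i : ℕ | x i ≤ (j : ℤ)}.ncard

theorem Admissible.lt_particleCount_iff {x : ℕ → ℤ} (hx : Admissible x) (i j : ℕ) :
    i < particleCount x j ↔ x i ≤ j := by
  have hmono : StrictMono x := strictMono_nat_of_lt_succ hx.lt_succ
  have hex : ∃ n, (j : ℤ) < x n := ⟨j, by have := hx.le j; omega⟩
  classical
  have hset : {i : ℕ | x i ≤ (j : ℤ)} = Set.Iio (Nat.find hex) := by
    ext k
    rw [Set.mem_ofPred_eq, Set.mem_Iio, Nat.lt_find_iff]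
    refine ⟨fun h m hm => not_lt.2 ((hmono.monotone hm).trans h), fun h => not_lt.1 (h k le_rfl)⟩
  have hcard : particleCount x j = Nat.find hex := by
    rw [particleCount, hset, ← Finset.coe_Iio, Set.ncard_coe_finset, Nat.card_Iio]
  rw [hcard, ← Set.mem_Iio, ← hset, Set.mem_ofPred_eq]

theorem Admissible.particleCount_le {x : ℕ → ℤ} (hx : Admissible x) (j : ℕ) :
    particleCount x j ≤ j := by
  rw [← not_lt, hx.lt_particleCount_iff]
  have := hx.le j
  omega

/-- The numbers of holes at locations `1, …, j`, in the order of decreasing `j`. -/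
noncomputable def holeList (x : ℕ → ℤ) : ℕ → List ℕ
  | 0 => []
  | j + 1 => (j + 1 - particleCount x (j + 1)) :: holeList x j

theorem length_holeList (x : ℕ → ℤ) (j : ℕ) : (holeList x j).length = j := by
  induction j with
  | zero => rfl
  | succ j ih => rw [holeList, List.length_cons, ih]

theorem headD_holeList (x : ℕ → ℤ) (j : ℕ) :
    (holeList x j).headD 0 = j - particleCount x j := by
  cases j <;> simp [holeList]

/-- The lists of the numbers of holes after one time step with coins `c`. -/
def evolve (c : ℕ → Bool) : List ℕ → List ℕ
  | [] => []
  -- If `l` lists the holes up to site `j`, then `l.length - l.headD 0` is the number of particles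
  -- there, hence the index of the first particle to the right of `j`.
  | m :: l => nextLen m l (evolve c l) (c (l.length - l.headD 0)).toNat :: evolve c l

/-- If site `j + 1` is a hole, the first term of the maximum dominates: no particle right of `j + 1`
comes back, and none at or left of `j` passes it. If it is occupied, its particle leaves either by
its own coin (third term) or when pushed, that is when a particle leaves `j` and the hole count up
to `j` grows (second term). -/
theorem Admissible.particleCount_step {x : ℕ → ℤ} (hx : Admissible x) (c : ℕ → Bool) (j : ℕ) :
    j + 1 - particleCount (PushTASEP.step c x) (j + 1)
      = max (j + 1 - particleCount x (j + 1)) (max (j - particleCount (PushTASEP.step c x) j)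
        (j - particleCount x j + (c (particleCount x j)).toNat)) := by
  have hy := hx.step c
  have a0 := hx.particleCount_le j
  have hx0 := fun i => hx.lt_particleCount_iff i j
  have hx1 := fun i => hx.lt_particleCount_iff i (j + 1)
  have hy0 := fun i => hy.lt_particleCount_iff i j
  have hy1 := fun i => hy.lt_particleCount_iff i (j + 1)
  have hs := step_eq_or c x
  push_cast at hx1 hy1
  have hc : (c (particleCount x j)).toNat = if c (particleCount x j) = true then 1 else 0 := by
    cases c (particleCount x j) <;> rfl
  rw [hc]
  rcases hk : particleCount x j with _ | k
  · have s0 : PushTASEP.step c x 0 = if c 0 = true then x 0 + 1 else x 0 := rfl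
    have l0 := hx.lt_succ 0
    rw [zero_add] at l0
    have e0 : ¬ x 0 ≤ j := by have := hx0 0; omega
    have e1 : particleCount x (j + 1) = if x 0 ≤ j + 1 then 1 else 0 := by
      have := hx1 0; have := hx1 1; split_ifs <;> omega
    have e2 : particleCount (PushTASEP.step c x) j = 0 := by
      have := hy0 0; have := hs 0; omega
    have e3 : particleCount (PushTASEP.step c x) (j + 1)
        = if PushTASEP.step c x 0 ≤ j + 1 then 1 else 0 := by
      have := hy1 0; have := hy1 1; have := hs 1; split_ifs <;> omega
    clear hx0 hx1 hy0 hy1 hs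
    rw [e1, e2, e3, s0]
    by_cases hc0 : c 0 = true <;> simp only [hc0, if_true, Bool.false_eq_true, if_false] <;> split_ifs <;> omega
  · have s0 : PushTASEP.step c x (k + 1) = if c (k + 1) = true ∨ (x (k + 1) = x k + 1 ∧
        x k + 1 = PushTASEP.step c x k) then x (k + 1) + 1 else x (k + 1) := rfl
    have l0 := hx.lt_succ k
    have l1 := hx.lt_succ (k + 1)
    have s1 := hs k
    have s2 := hs (k + 1 + 1)
    have d0 : x k ≤ j := by have := hx0 k; omega
    have d1 : ¬ x (k + 1) ≤ j := by have := hx0 (k + 1); omega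
    have e1 : particleCount x (j + 1) = if x (k + 1) ≤ j + 1 then k + 2 else k + 1 := by
      have := hx1 k; have := hx1 (k + 1); have := hx1 (k + 1 + 1); split_ifs <;> omega
    have e2 : particleCount (PushTASEP.step c x) j
        = if PushTASEP.step c x k ≤ j then k + 1 else k := by
      have h1 : k ≤ particleCount (PushTASEP.step c x) j := by
        rcases k with _ | k
        · exact Nat.zero_le _
        · have := hy0 k; have := hs k; have := hx.lt_succ k; omega
      have := hy0 k; have := hy0 (k + 1); have := hs (k + 1); split_ifs <;> omega
    have e3 : particleCount (PushTASEP.step c x) (j + 1)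
        = if PushTASEP.step c x (k + 1) ≤ j + 1 then k + 2 else k + 1 := by
      have := hy1 k; have := hy1 (k + 1); have := hy1 (k + 1 + 1); split_ifs <;> omega
    clear hx0 hx1 hy0 hy1 hs
    rw [e1, e2, e3, s0]
    clear e1 e2 e3 s0
    by_cases hck : c (k + 1) = true
    · simp only [hck, true_or, if_true]
      split_ifs <;> omega
    · simp only [hck, Bool.false_eq_true, false_or, if_false]
      split_ifs <;> omega

theorem Admissible.holeList_step {x : ℕ → ℤ} (hx : Admissible x) (c : ℕ → Bool) (N : ℕ) :
    holeList (PushTASEP.step c x) N = evolve c (holeList x N) := by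
  induction N with
  | zero => rfl
  | succ j ih =>
    simp only [holeList, evolve, ← ih, nextLen, length_holeList, headD_holeList]
    rw [hx.particleCount_step c j, Nat.sub_sub_self (hx.particleCount_le j)]

/-- The numbers of holes at time `t`. -/
def holeState (ξ : ℕ → ℕ → Bool) (N : ℕ) : ℕ → List ℕ
  | 0 => List.replicate N 0
  | t + 1 => evolve (ξ t) (holeState ξ N t)

theorem holeList_position (ξ : ℕ → ℕ → Bool) (N t : ℕ) :
    holeList (position ξ t) N = holeState ξ N t := by
  induction t with
  | zero =>
    have h : ∀ j, particleCount (position ξ 0) j = j := fun j =>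
      eq_of_forall_lt_iff fun i => by
        rw [(admissible_position ξ 0).lt_particleCount_iff]; simp only [position]; omega
    have h2 : ∀ j, holeList (position ξ 0) j = List.replicate j 0 := fun j => by
      induction j with
      | zero => rfl
      | succ j ih => rw [holeList, ih, h, Nat.sub_self]; rfl
    exact h2 N
  | succ t ih => rw [position, (admissible_position ξ t).holeList_step, ih, holeState]

theorem height_eq (ξ : ℕ → ℕ → Bool) (t N : ℕ) :
    height ξ t N = N - (holeState ξ N t).headD 0 := by
  rw [← holeList_position, headD_holeList,
    Nat.sub_sub_self ((admissible_position ξ t).particleCount_le N)]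
  rfl

/-- Each entry of the list equals the next one or exceeds it by one. -/
def IsHoleList : List ℕ → Prop
  | [] => True
  | m :: l => (m = l.headD 0 ∨ m = l.headD 0 + 1) ∧ IsHoleList l

theorem IsHoleList.headD_le : ∀ {l : List ℕ}, IsHoleList l → l.headD 0 ≤ l.length
  | [], _ => le_rfl
  | m :: l, h => by
    have := h.2.headD_le
    have := h.1
    simp only [List.headD_cons, List.length_cons]
    omega

theorem IsHoleList.evolve_aux {l : List ℕ} (hl : IsHoleList l) (c : ℕ → Bool) :
    IsHoleList (evolve c l) ∧ l.headD 0 ≤ (evolve c l).headD 0 ∧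
      (evolve c l).headD 0 ≤ l.headD 0 + 1 := by
  induction l with
  | nil => exact ⟨trivial, le_rfl, Nat.zero_le _⟩
  | cons m l ih =>
    obtain ⟨h1, h2, h3⟩ := ih hl.2
    have h4 := hl.1
    have h5 := Bool.toNat_le (c (l.length - l.headD 0))
    simp only [evolve, IsHoleList, nextLen, List.headD_cons, h1, and_true]
    omega

theorem isHoleList_holeState (ξ : ℕ → ℕ → Bool) (N t : ℕ) : IsHoleList (holeState ξ N t) := by
  induction t with
  | zero =>
    rw [holeState]
    induction N with
    | zero => trivial
    | succ N ih => exact ⟨by cases N <;> simp [List.replicate_succ], ih⟩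
  | succ t ih => exact (ih.evolve_aux _).1

theorem evolve_cons_apply (m : ℕ) (l : List ℕ) (c : ℕ → Bool)
    (G : List ℕ → ENNReal) : G (evolve c (m :: l)) =
      if c (l.length - l.headD 0) = true then G (nextLen m l (evolve c l) 1 :: evolve c l)
      else G (nextLen m l (evolve c l) 0 :: evolve c l) := by
  rw [evolve]
  cases c (l.length - l.headD 0) <;> simp

/-- Only coins of particles inside the window matter, which leaves the coin of the next particle
independent of the new list. Lists carry no σ-algebra here, so measurability is tested through
functions `G`. -/
theorem measurable_evolve {Ω : Type*} {mΩ : MeasurableSpace Ω} {c : ℕ → Ω → Bool} {l : List ℕ}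
    (hl : IsHoleList l) (hc : ∀ i < l.length - l.headD 0, Measurable (c i))
    (G : List ℕ → ENNReal) : Measurable fun ω => G (evolve (fun i => c i ω) l) := by
  induction l generalizing G with
  | nil => exact measurable_const (a := G [])
  | cons m l ih =>
    have hlen := hl.2.headD_le
    simp only [List.length_cons, List.headD_cons] at hc
    have hm := hl.1
    have ih' := ih hl.2 fun i hi => hc i (by omega)
    rcases hm with rfl | rfl
    · simp only [evolve_cons_apply]
      refine Measurable.ite ?_ (ih' fun l' => G (nextLen _ l l' 1 :: l'))
        (ih' fun l' => G (nextLen _ l l' 0 :: l'))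
      exact hc _ (by omega) (measurableSet_singleton true)
    -- The next site is a hole: the new entry is `l.headD 0 + 1` whatever the coin, which lies
    -- outside the allowed range.
    · have h : ∀ ω, evolve (fun i => c i ω) ((l.headD 0 + 1) :: l)
          = (l.headD 0 + 1) :: evolve (fun i => c i ω) l := fun ω => by
        have h1 := hl.2.evolve_aux fun i => c i ω
        have h5 := Bool.toNat_le (c (l.length - l.headD 0) ω)
        simp only [evolve, nextLen]
        congr 1
        omega
      simp only [h]
      exact ih' fun l' => G ((l.headD 0 + 1) :: l')

/-! ### The law of the numbers of holes -/

section Law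

variable {Ω : Type*} {ξ : ℕ → ℕ → Ω → Bool}

/-- The σ-algebra generated by the coins in `S`. -/
abbrev coinAlgebra (ξ : ℕ → ℕ → Ω → Bool) (S : Set (ℕ × ℕ)) : MeasurableSpace Ω :=
  ⨆ a ∈ S, MeasurableSpace.comap (ξ a.1 a.2) inferInstance

theorem measurable_coin {S : Set (ℕ × ℕ)} {t i : ℕ} (h : (t, i) ∈ S) :
    Measurable[coinAlgebra ξ S] (ξ t i) :=
  Measurable.mono (comap_measurable (ξ t i))
    (le_iSup₂ (f := fun (a : ℕ × ℕ) (_ : a ∈ S) => MeasurableSpace.comap (ξ a.1 a.2) inferInstance)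
      (t, i) h) le_rfl

theorem coinAlgebra_mono {S T : Set (ℕ × ℕ)} (h : S ⊆ T) : coinAlgebra ξ S ≤ coinAlgebra ξ T :=
  biSup_mono h

/-- Splitting over the values of the state separates past coins from those in `H`, so that
independence applies term by term. -/
theorem apply_evolve_holeState (N t : ℕ) (H : List ℕ → Ω → ENNReal) (ω : Ω) :
    H (holeState (fun r i => ξ r i ω) N t) ω = ∑' l : {l : List ℕ // IsHoleList l},
      (if l.1 = holeState (fun r i => ξ r i ω) N t then 1 else 0) * H l.1 ω := by
  rw [tsum_eq_single ⟨_, isHoleList_holeState (fun r i => ξ r i ω) N t⟩]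
  · simp
  · intro l hl
    rw [if_neg fun h => hl (Subtype.ext h), zero_mul]

theorem measurable_holeState (N t : ℕ) (G : List ℕ → ENNReal) :
    Measurable[coinAlgebra ξ {a | a.1 < t}] fun ω => G (holeState (fun r i => ξ r i ω) N t) := by
  induction t generalizing G with
  | zero => exact measurable_const (a := G (List.replicate N 0))
  | succ t ih =>
    let _ : MeasurableSpace Ω := coinAlgebra ξ {a | a.1 < t + 1}
    simp only [holeState]
    simp only [apply_evolve_holeState N t fun l ω => G (evolve (fun i => ξ t i ω) l)]
    refine Measurable.tsum fun l => Measurable.mul ?_ ?_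
    · exact (ih fun L => if l.1 = L then 1 else 0).mono
        (coinAlgebra_mono fun a ha => Nat.lt_succ_of_lt ha) le_rfl
    · exact measurable_evolve l.2 (fun i _ => measurable_coin (Nat.lt_add_one t)) G

variable [mΩ : MeasurableSpace Ω] {P : Measure Ω} {p : ℝ}

theorem IsBernoulliCoins.coinAlgebra_le (hξ : IsBernoulliCoins P p ξ) (S : Set (ℕ × ℕ)) :
    coinAlgebra ξ S ≤ mΩ :=
  iSup₂_le fun a _ => (hξ.measurable a.1 a.2).comap_le

theorem IsBernoulliCoins.lintegral_mul (hξ : IsBernoulliCoins P p ξ) {S T : Set (ℕ × ℕ)}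
    (hST : Disjoint S T) {f g : Ω → ENNReal} (hf : Measurable[coinAlgebra ξ S] f)
    (hg : Measurable[coinAlgebra ξ T] g) :
    ∫⁻ ω, f ω * g ω ∂P = (∫⁻ ω, f ω ∂P) * ∫⁻ ω, g ω ∂P :=
  have h : Indep (coinAlgebra ξ S) (coinAlgebra ξ T) P :=
    indep_iSup_of_disjoint (m := fun a : ℕ × ℕ => MeasurableSpace.comap (ξ a.1 a.2) inferInstance)
      (fun a => (hξ.measurable a.1 a.2).comap_le) hξ.indep.iIndep hST
  lintegral_mul_eq_lintegral_mul_lintegral_of_independent_measurableSpace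
    (hξ.coinAlgebra_le S) (hξ.coinAlgebra_le T) h hf hg

variable [IsProbabilityMeasure P]

theorem IsBernoulliCoins.lintegral_ite (hξ : IsBernoulliCoins P p ξ) {S : Set (ℕ × ℕ)} {t i : ℕ}
    (h : (t, i) ∉ S) {f g : Ω → ENNReal} (hf : Measurable[coinAlgebra ξ S] f)
    (hg : Measurable[coinAlgebra ξ S] g) :
    ∫⁻ ω, (if ξ t i ω = true then f ω else g ω) ∂P
      = ENNReal.ofReal p * (∫⁻ ω, f ω ∂P) + (1 - ENNReal.ofReal p) * ∫⁻ ω, g ω ∂P := by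
  have hms : MeasurableSet {ω | ξ t i ω = true} :=
    hξ.measurable t i (measurableSet_singleton true)
  have hST : Disjoint {(t, i)} S := Set.disjoint_singleton_left.2 h
  have hcoin := measurable_coin (ξ := ξ) (Set.mem_singleton (t, i))
  have h1 : Measurable[coinAlgebra ξ {(t, i)}]
      fun ω => if ξ t i ω = true then (1 : ENNReal) else 0 :=
    (measurable_of_countable fun b : Bool => if b = true then (1 : ENNReal) else 0).comp hcoin
  have h2 : Measurable[coinAlgebra ξ {(t, i)}]
      fun ω => if ξ t i ω = true then (0 : ENNReal) else 1 :=
    (measurable_of_countable fun b : Bool => if b = true then (0 : ENNReal) else 1).comp hcoin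
  have e1 : ∫⁻ ω, (if ξ t i ω = true then (1 : ENNReal) else 0) ∂P = ENNReal.ofReal p := by
    rw [← hξ.prob_success t i, ← lintegral_indicator_one hms]
    exact lintegral_congr fun ω => by simp [Set.indicator_apply]
  have e2 : ∫⁻ ω, (if ξ t i ω = true then (0 : ENNReal) else 1) ∂P = 1 - ENNReal.ofReal p := by
    rw [← hξ.prob_success t i, ← prob_compl_eq_one_sub hms, ← lintegral_indicator_one hms.compl]
    exact lintegral_congr fun ω => by by_cases hω : ξ t i ω = true <;> simp [hω]
  rw [← e2, ← e1, ← hξ.lintegral_mul hST h1 hf, ← hξ.lintegral_mul hST h2 hg,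
    ← lintegral_add_left]
  · refine lintegral_congr fun ω => ?_
    split_ifs <;> simp
  · exact (h1.mono (hξ.coinAlgebra_le _) le_rfl).mul (hf.mono (hξ.coinAlgebra_le _) le_rfl)

theorem IsBernoulliCoins.lintegral_evolve (hξ : IsBernoulliCoins P p ξ) (t : ℕ) {l : List ℕ}
    (hl : IsHoleList l) (G : List ℕ → ENNReal) :
    ∫⁻ ω, G (evolve (fun i => ξ t i ω) l) ∂P = rowKernel (ENNReal.ofReal p) G l := by
  induction l generalizing G with
  | nil => simp [evolve, rowKernel]
  | cons m l ih =>
    -- These coins determine the new tail; the head reads the coin of index `l.length - l.headD 0`,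
    -- just outside `S`.
    let S : Set (ℕ × ℕ) := {a | a.1 = t ∧ a.2 < l.length - l.headD 0}
    have hmeas : ∀ G : List ℕ → ENNReal,
        Measurable[coinAlgebra ξ S] fun ω => G (evolve (fun i => ξ t i ω) l) :=
      measurable_evolve (mΩ := coinAlgebra ξ S) hl.2 fun i hi => measurable_coin ⟨rfl, hi⟩
    have hmeas' := fun G => (hmeas G).mono (hξ.coinAlgebra_le S) le_rfl
    simp only [evolve_cons_apply, rowKernel]
    rw [← ih hl.2, hξ.lintegral_ite (S := S) (fun h => lt_irrefl _ h.2)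
      (hmeas fun l' => G (nextLen m l l' 1 :: l')) (hmeas fun l' => G (nextLen m l l' 0 :: l')),
      lintegral_add_left ((hmeas' fun l' => G (nextLen m l l' 0 :: l')).const_mul _),
      lintegral_const_mul _ (hmeas' fun l' => G (nextLen m l l' 0 :: l')),
      lintegral_const_mul _ (hmeas' fun l' => G (nextLen m l l' 1 :: l')), add_comm]

theorem IsBernoulliCoins.lintegral_holeState (hξ : IsBernoulliCoins P p ξ) (N t : ℕ)
    (G : List ℕ → ENNReal) :
    ∫⁻ ω, G (holeState (fun r i => ξ r i ω) N t) ∂P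
      = ((rowKernel (ENNReal.ofReal p))^[t] G) (List.replicate N 0) := by
  induction t generalizing G with
  | zero => simp [holeState]
  | succ t ih =>
    have h1 : ∀ l : {l : List ℕ // IsHoleList l}, Measurable[coinAlgebra ξ {a | a.1 < t}]
        fun ω => if l.1 = holeState (fun r i => ξ r i ω) N t then (1 : ENNReal) else 0 :=
      fun l => measurable_holeState N t fun L => if l.1 = L then 1 else 0
    have h2 : ∀ l : {l : List ℕ // IsHoleList l}, Measurable[coinAlgebra ξ {a | a.1 = t}]
        fun ω => G (evolve (fun i => ξ t i ω) l.1) :=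
      fun l => measurable_evolve (mΩ := coinAlgebra ξ {a | a.1 = t}) l.2
        (fun i _ => measurable_coin rfl) G
    have h1' := fun l => (h1 l).mono (hξ.coinAlgebra_le _) le_rfl
    have h2' := fun l => (h2 l).mono (hξ.coinAlgebra_le _) le_rfl
    have hd : Disjoint {a : ℕ × ℕ | a.1 < t} {a | a.1 = t} :=
      Set.disjoint_left.2 fun a ha hb => lt_irrefl t (hb ▸ ha)
    rw [Function.iterate_succ_apply, ← ih]
    simp only [holeState]
    simp only [apply_evolve_holeState N t fun l ω => G (evolve (fun i => ξ t i ω) l),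
      apply_evolve_holeState N t fun l ω => rowKernel (ENNReal.ofReal p) G l]
    refine (lintegral_tsum fun l => (h1' l).aemeasurable.mul (h2' l).aemeasurable).trans
      (Eq.trans (tsum_congr fun l => ?_)
        (lintegral_tsum fun l => (h1' l).aemeasurable.mul_const _).symm)
    refine (hξ.lintegral_mul hd (h1 l) (h2 l)).trans ?_
    rw [hξ.lintegral_evolve t l.2, lintegral_mul_const _ (h1' l)]

end Law

/-! ### Schur measures with constant specializations -/

theorem schur_const (μ : YoungDiagram) (n : ℕ) (a : ℝ) :
    schur μ (fun _ : Fin n => a) = Fintype.card (BoundedSSYT μ n) * a ^ μ.card := by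
  simp [schur, YoungDiagram.card]

/-- The first column increases strictly, so its entry in row `i` is at least `i`. Hence diagrams
with more than `N` rows contribute nothing and signatures suffice. -/
theorem card_boundedSSYT_eq_zero {μ : YoungDiagram} {n : ℕ} (h : n < μ.colLen 0) :
    Fintype.card (BoundedSSYT μ n) = 0 := by
  rw [Fintype.card_eq_zero_iff]
  refine ⟨fun T => ?_⟩
  have key : ∀ i, i < μ.colLen 0 → i ≤ T.1 i 0 := by
    intro i
    induction i with
    | zero => exact fun _ => Nat.zero_le _
    | succ i ih =>
      intro hi
      have := ih (by omega)
      have := T.1.col_strict (Nat.lt_add_one i) (YoungDiagram.mem_iff_lt_colLen.2 hi)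
      omega
  exact absurd (T.2 ⟨(n, 0), YoungDiagram.mem_iff_lt_colLen.2 h⟩) (not_lt.2 (key n h))

namespace NonnegSignature

variable {N : ℕ}

theorem rowLen_diagram (μ : NonnegSignature N) (i : ℕ) :
    μ.diagram.rowLen i = if h : i < N then μ.1 ⟨i, h⟩ else 0 := by
  refine eq_of_forall_lt_iff fun j => ?_
  rw [← YoungDiagram.mem_iff_lt_rowLen, diagram, YoungDiagram.mem_ofRowLens]
  split_ifs with h
  · simp [h]
  · simp [h]

theorem colLen_diagram_le (μ : NonnegSignature N) : μ.diagram.colLen 0 ≤ N := by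
  rw [← rowLen_eq_zero_iff, rowLen_diagram, dif_neg (lt_irrefl N)]

theorem diagram_injective : Function.Injective (diagram (N := N)) := by
  intro μ ν h
  refine Subtype.ext (funext fun i => ?_)
  have h1 := rowLen_diagram μ i
  have h2 := rowLen_diagram ν i
  rw [dif_pos i.2] at h1 h2
  rw [← h1, ← h2, h]

theorem exists_diagram_eq {μ : YoungDiagram} (h : μ.colLen 0 ≤ N) :
    ∃ ν : NonnegSignature N, ν.diagram = μ := by
  have ha : Antitone fun i : Fin N => μ.rowLen i := fun i j hij => μ.rowLen_anti i j hij
  let ν : NonnegSignature N := ⟨fun i => μ.rowLen i, ha⟩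
  refine ⟨ν, youngDiagram_ext fun i => ?_⟩
  rw [rowLen_diagram]
  split_ifs with hi
  · rfl
  · exact (rowLen_eq_zero_iff.2 (by omega)).symm

theorem zeroParts_eq (μ : NonnegSignature N) : μ.zeroParts = N - μ.diagram.colLen 0 := by
  have h1 : (Finset.univ.filter fun i => ¬ μ.1 i = 0).card = μ.diagram.colLen 0 := by
    have h2 : (Finset.univ.filter fun i : Fin N => ¬ μ.1 i = 0).map Fin.valEmbedding
        = Finset.range (μ.diagram.colLen 0) := by
      ext i
      have h3 := μ.colLen_diagram_le
      rw [Finset.mem_range, lt_colLen_zero_iff, rowLen_diagram]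
      simp only [Finset.mem_map, Finset.mem_filter, Finset.mem_univ, true_and,
        Fin.valEmbedding_apply]
      constructor
      · rintro ⟨j, hj, rfl⟩
        rw [dif_pos j.2]
        exact Nat.pos_of_ne_zero hj
      · intro hi
        split_ifs at hi with h
        · exact ⟨⟨i, h⟩, hi.ne', rfl⟩
        · exact absurd hi (lt_irrefl 0)
    rw [← Finset.card_map Fin.valEmbedding, h2, Finset.card_range]
  have h4 := Finset.card_filter_add_card_filter_not (s := (Finset.univ : Finset (Fin N)))
    fun i => μ.1 i = 0
  rw [Finset.card_univ, Fintype.card_fin, h1] at h4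
  rw [zeroParts]
  omega

theorem tsum_diagram (F : YoungDiagram → ENNReal) (hF : ∀ μ, N < μ.colLen 0 → F μ = 0) :
    ∑' μ : NonnegSignature N, F μ.diagram = ∑' μ : YoungDiagram, F μ := by
  refine diagram_injective.tsum_eq fun μ hμ => ?_
  by_contra h
  exact hμ (hF μ (not_le.1 fun h1 => h (exists_diagram_eq h1)))

end NonnegSignature

theorem ofReal_schurWeight_const {t N : ℕ} {u v : ℝ} (hu : 0 ≤ u) (hv : 0 < v)
    (μ : NonnegSignature N) :
    ENNReal.ofReal (schurWeight (fun _ : Fin t => v⁻¹) (fun _ : Fin N => u) μ)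
      = ENNReal.ofReal (u / v) ^ μ.diagram.card * Fintype.card (BoundedSSYT μ.diagram t)
        * Fintype.card (BoundedSSYT μ.diagram N) := by
  have h : schurWeight (fun _ : Fin t => v⁻¹) (fun _ : Fin N => u) μ
      = (u / v) ^ μ.diagram.card * Fintype.card (BoundedSSYT μ.diagram t)
        * Fintype.card (BoundedSSYT μ.diagram N) := by
    rw [schurWeight, schur_const, schur_const, div_eq_mul_inv, mul_pow]
    ring
  have hp : 0 ≤ u / v := by positivity
  rw [h, ENNReal.ofReal_mul (by positivity), ENNReal.ofReal_mul (by positivity),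
    ENNReal.ofReal_pow hp, ENNReal.ofReal_natCast, ENNReal.ofReal_natCast]

theorem lintegral_schurMeasure {t N : ℕ} (x : Fin t → ℝ) (y : Fin N → ℝ)
    (f : NonnegSignature N → ENNReal) :
    ∫⁻ μ, f μ ∂schurMeasure x y
      = (schurZ x y)⁻¹ * ∑' μ, ENNReal.ofReal (schurWeight x y μ) * f μ := by
  rw [schurMeasure, lintegral_sum_measure, ← ENNReal.tsum_mul_left]
  refine tsum_congr fun μ => ?_
  rw [lintegral_smul_measure, lintegral_dirac' _ measurable_from_top, smul_eq_mul,
    div_eq_mul_inv, mul_comm _ (schurZ x y)⁻¹, mul_assoc]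

theorem IsBernoulliCoins.measurable_height {Ω : Type*} [MeasurableSpace Ω] {P : Measure Ω} {p : ℝ}
    {ξ : ℕ → ℕ → Ω → Bool} (hξ : IsBernoulliCoins P p ξ) (N t : ℕ) :
    Measurable fun ω => height (fun r i => ξ r i ω) t N := by
  refine measurable_to_countable' fun n => ?_
  have h := (measurable_holeState (ξ := ξ) N t
    fun L => if N - L.headD 0 = n then 1 else 0).mono (hξ.coinAlgebra_le _) le_rfl
  convert h (measurableSet_singleton 1) using 1
  ext ω
  simp [height_eq]

/-! ### Comparison of the two laws -/

section Main

variable {Ω : Type*} [MeasurableSpace Ω] {P : Measure Ω} [IsProbabilityMeasure P] {u v : ℝ}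
  {ξ : ℕ → ℕ → Ω → Bool}

/-- Up to the power of `(1 - q)⁻¹`, both sides are the `t`-fold kernel applied to `L ↦ G (N -
L.headD 0)` at `N` zeros. -/
theorem tsum_schurWeight_mul (hu : 0 ≤ u) (huv : u < v) (hξ : IsBernoulliCoins P (u / v) ξ)
    (N t : ℕ) (G : ℕ → ENNReal) :
    ∑' μ : NonnegSignature N, ENNReal.ofReal
        (schurWeight (fun _ : Fin t => v⁻¹) (fun _ : Fin N => u) μ) * G μ.zeroParts
      = (1 - ENNReal.ofReal (u / v))⁻¹ ^ (N * t)
        * ∫⁻ ω, G (height (fun r i => ξ r i ω) t N) ∂P := by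
  have hv : 0 < v := hu.trans_lt huv
  have hq : ENNReal.ofReal (u / v) < 1 := by
    rw [← ENNReal.ofReal_one, ENNReal.ofReal_lt_ofReal_iff one_pos]
    exact (div_lt_one hv).2 huv
  simp only [height_eq, ofReal_schurWeight_const hu hv, NonnegSignature.zeroParts_eq]
  rw [hξ.lintegral_holeState N t fun L => G (N - L.headD 0), ← tsum_card_mul_chainSum _ hq,
    NonnegSignature.tsum_diagram fun μ => ENNReal.ofReal (u / v) ^ μ.card *
      Fintype.card (BoundedSSYT μ t) * Fintype.card (BoundedSSYT μ N) * G (N - μ.colLen 0)]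
  · refine tsum_congr fun μ => ?_
    rw [chainSum_congr N μ (G := fun _ => G (N - μ.colLen 0) * 1)
      fun L hL => by rw [hL, mul_one], chainSum_const_mul, chainSum_one]
    ring
  · intro μ hμ
    rw [card_boundedSSYT_eq_zero hμ]
    simp

theorem lintegral_zeroParts (hu : 0 ≤ u) (huv : u < v) (hξ : IsBernoulliCoins P (u / v) ξ)
    (N t : ℕ) (G : ℕ → ENNReal) :
    ∫⁻ μ, G μ.zeroParts ∂schurMeasure (fun _ : Fin t => v⁻¹) (fun _ : Fin N => u)
      = ∫⁻ ω, G (height (fun r i => ξ r i ω) t N) ∂P := by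
  have hv : 0 < v := hu.trans_lt huv
  have hq : ENNReal.ofReal (u / v) < 1 := by
    rw [← ENNReal.ofReal_one, ENNReal.ofReal_lt_ofReal_iff one_pos]
    exact (div_lt_one hv).2 huv
  -- The case `G = 1` is the Cauchy identity; its value is finite and nonzero because `q < 1`.
  have hZ : schurZ (fun _ : Fin t => v⁻¹) (fun _ : Fin N => u)
      = (1 - ENNReal.ofReal (u / v))⁻¹ ^ (N * t) := by
    simpa [schurZ] using tsum_schurWeight_mul hu huv hξ N t fun _ => 1
  have h1 : (1 - ENNReal.ofReal (u / v))⁻¹ ^ (N * t) ≠ 0 :=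
    pow_ne_zero _ (ENNReal.inv_ne_zero.2 (ENNReal.sub_ne_top ENNReal.one_ne_top))
  have h2 : (1 - ENNReal.ofReal (u / v))⁻¹ ^ (N * t) ≠ ⊤ :=
    ENNReal.pow_ne_top (ENNReal.inv_ne_top.2 (tsub_pos_of_lt hq).ne')
  rw [lintegral_schurMeasure, tsum_schurWeight_mul hu huv hξ, hZ, ← mul_assoc,
    ENNReal.inv_mul_cancel h1 h2, one_mul]

end Main

end PushTASEP

theorem mainTheorem12 {Ω : Type*} [MeasurableSpace Ω] (P : Measure Ω) [IsProbabilityMeasure P]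
    (u v : ℝ) (hu : 0 ≤ u) (huv : u < v) (ξ : ℕ → ℕ → Ω → Bool)
    (hξ : PushTASEP.IsBernoulliCoins P (u / v) ξ) (N t : ℕ) (hN : 1 ≤ N) :
    IsProbabilityMeasure
        (PushTASEP.schurMeasure (fun _ : Fin t => v⁻¹) (fun _ : Fin N => u)) ∧
      IdentDistrib (fun ω => PushTASEP.height (fun r i => ξ r i ω) t N)
        (fun μ : PushTASEP.NonnegSignature N => μ.zeroParts) P
        (PushTASEP.schurMeasure (fun _ : Fin t => v⁻¹) (fun _ : Fin N => u)) := by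
  have key := PushTASEP.lintegral_zeroParts hu huv hξ N t
  refine ⟨⟨?_⟩, (hξ.measurable_height N t).aemeasurable,
    (measurable_from_top (f := fun μ : PushTASEP.NonnegSignature N => μ.zeroParts)).aemeasurable,
    Measure.ext_of_lintegral _ fun G hG => ?_⟩
  · simpa using key fun _ => 1
  · rw [lintegral_map hG (hξ.measurable_height N t), lintegral_map hG measurable_from_top, key]
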